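/- Conventions. Let $L$ be a poset with bottom element $0$. A filter of $L$ is a nonempty down-directed upper subset. Write $s\gg r$ ($s$ is way-above $r$) if every filter $F$ of $L$ that has an infimum $\bigwedge F\leqslant r$ contains $s$. $L$ is a domain if every filter of $L$ has an infimum and if, for every $r\in L$, the set $\{s\in L: s\gg r\}$ is a filter with infimum $r$. Let $E$ be a topological space that is quasisober (every irreducible closed subset is the closure of a point; $E$ need not be $T_0$). The saturation $\uparrow\! A$ of $A\subset E$ is the intersection of all open sets containing $A$, and $A$ is saturated if $A=\uparrow\! A$. Let $\mathscr G$ be the collection of open subsets, $\mathscr Q$ the collection of compact saturated subsets, $\mathscr B$ the $\sigma$-algebra generated by $\mathscr G\cup\mathscr Q$ (its elements are the Borel sets), and $\mathscr K$ the collection of compact Borel subsets. (As $E$ is quasisober, $\mathscr Q$ is closed under filtered intersections.) "Locally compact" means that every point has a neighbourhood base of compact sets. A map $\nu:\mathscr B\to L$ with $\nu(\emptyset)=0$ is a maxitive (resp. $\sigma$-maxitive, completely maxitive) measure if, for every finite (resp. countable, arbitrary) family $(B_j)_j$ in $\mathscr B$ with $\bigcup_j B_j\in\mathscr B$, the supremum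 $\bigoplus_j\nu(B_j)$ exists and equals $\nu(\bigcup_j B_j)$. For such a $\nu$ put $\nu^+(A)=\bigwedge\{\nu(G):G\in\mathscr G,\ G\supset A\}$ for $A \in \mathscr B$. A maxitive measure $\nu$ is * inner-continuous if $\nu(B)=\bigoplus\{\nu(\uparrow\! K):K\in\mathscr K,\ K\subset B\}$ for all $B\in\mathscr B$; outer-continuous if $\nu(B)=\nu^+(B)$ for all $B\in\mathscr B$; regular if it is both; * weakly inner-continuous if $\nu(G)=\bigoplus\{\nu^+(K):K\in\mathscr K,\ K\subset G\}$ for all $G\in\mathscr G$; weakly outer-continuous if $\nu(K)=\nu^+(K)$ for all $K\in\mathscr K$; * $\mathscr Q$-smooth if $\nu(\bigcap_j Q_j)=\bigwedge_j\nu(Q_j)$ for every nonempty filtered family $(Q_j)_j$ in $\mathscr Q$; * saturated if $\nu(K)=\nu(\uparrow\! K)$ for all $K\in\mathscr K$. A cardinal density of $\nu$ is a map $c:E\to L$ with $\nu(B)=\bigoplus_{x\in B}c(x)$ for all $B\in\mathscr B$; it is usc (upper-semicontinuous) if $\{x\in E:t\gg c(x)\}$ is open for every $t\in L$. Theorem.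 Let $L$ be a domain with a bottom element, $E$ a quasisober space, and $\nu$ an $L$-valued maxitive measure on $\mathscr B$. Then $\nu$ has a cardinal density if and only if $\nu$ is completely maxitive. Also, consider the following assertions: 1. $\nu$ is regular; 2. $\nu$ has a usc cardinal density; 3. $\nu$ is outer-continuous and completely maxitive; 4. $\nu$ is weakly outer-continuous and weakly inner-continuous; 5. $\nu$ is weakly outer-continuous and $\sigma$-maxitive; 6. $\nu$ is weakly outer-continuous; 7. $\nu$ is $\mathscr Q$-smooth and saturated; 8. $\nu$ is $\mathscr Q$-smooth, weakly inner-continuous, and saturated; 9. $\nu$ is $\mathscr Q$-smooth, $\sigma$-maxitive, and saturated. Then (1) $\Leftrightarrow$ (2) $\Leftrightarrow$ (3) $\Leftrightarrow$ (4) $\Rightarrow$ (5) $\Rightarrow$ (6) $\Rightarrow$ (7) $\Leftarrow$ (8). Moreover, * if $E$ is second-countable, then (1) $\Leftrightarrow$ (2) $\Leftrightarrow$ (3) $\Leftrightarrow$ (4) $\Leftrightarrow$ (5); * if $E$ is locally compact, then (8) $\Leftrightarrow$ (1) $\Leftrightarrow$ (2) $\Leftrightarrow$ (3) $\Leftrightarrow$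 (4), and (6) $\Leftrightarrow$ (7); * if $E$ is $\sigma$-compact and metrizable, then (9) $\Leftrightarrow$ (1) $\Leftrightarrow$ (2) $\Leftrightarrow$ (3) $\Leftrightarrow$ (4) $\Leftrightarrow$ (5); * if $E$ is locally compact Polish, then (8) $\Leftrightarrow$ (9) $\Leftrightarrow$ (1) $\Leftrightarrow$ (2) $\Leftrightarrow$ (3) $\Leftrightarrow$ (4) $\Leftrightarrow$ (5), and (6) $\Leftrightarrow$ (7). -/

import Mathlib

/-! ### Domains (in the order-dual sense: filters, infima, way-above) -/

section Domain

/-- `WayAbove s r` (written `s ≫ r`): for every filter `F` of `L` that has an infimum `m`,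
if `m ≤ r` then `s ∈ F`. (An `Order.IsPFilter` is a nonempty, down-directed upper set.) -/
def WayAbove {L : Type*} [PartialOrder L] (s r : L) : Prop :=
  ∀ (F : Set L) (m : L), Order.IsPFilter F → IsGLB F m → m ≤ r → s ∈ F

/-- A poset is continuous if, for every `r`, the set of elements way-above `r` is a filter
whose infimum is `r`. -/
def IsContinuousPoset (L : Type*) [PartialOrder L] : Prop :=
  ∀ r : L, Order.IsPFilter {s : L | WayAbove s r} ∧ IsGLB {s : L | WayAbove s r} r

/-- A poset is filtered-complete if every filter has an infimum. -/
def IsFilteredComplete (L : Type*) [PartialOrder L] : Prop :=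
  ∀ F : Set L, Order.IsPFilter F → ∃ m : L, IsGLB F m

/-- A domain is a filtered-complete continuous poset. -/
def IsFilteredDomain (L : Type*) [PartialOrder L] : Prop :=
  IsFilteredComplete L ∧ IsContinuousPoset L

end Domain

/-! ### Borel sets of a topological space that need not be Hausdorff

The saturation of a set `A` (the intersection of all open sets containing `A`) is Mathlib's
`nhdsKer A`. -/

section Borel

/-- A set is saturated if it is an intersection of open sets, i.e. equal to its saturation. -/
def IsSaturatedSet {E : Type*} [TopologicalSpace E] (A : Set E) : Prop :=
  nhdsKer A = A

/-- The σ-algebra generated by the open sets and the compact saturated sets. -/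
abbrev saturatedBorel (E : Type*) [TopologicalSpace E] : MeasurableSpace E :=
  MeasurableSpace.generateFrom
    ({G : Set E | IsOpen G} ∪ {Q : Set E | IsCompact Q ∧ IsSaturatedSet Q})

/-- The collection of Borel subsets of `E`. -/
abbrev BorelSet (E : Type*) [TopologicalSpace E] : Type _ :=
  {B : Set E // @MeasurableSet E (saturatedBorel E) B}

/-- The empty Borel set. -/
def BorelSet.empty (E : Type*) [TopologicalSpace E] : BorelSet E :=
  ⟨∅, @MeasurableSet.empty E (saturatedBorel E)⟩

/-- The saturation of a compact set is compact and saturated, hence Borel. -/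
theorem measurableSet_nhdsKer_of_isCompact {E : Type*} [TopologicalSpace E] {K : Set E}
    (hK : IsCompact K) : @MeasurableSet E (saturatedBorel E) (nhdsKer K) := by
  refine MeasurableSpace.measurableSet_generateFrom (Or.inr ⟨?_, ?_⟩)
  · exact hK.nhdsKer
  · exact Set.Subset.antisymm
      (fun x hx => mem_nhdsKer.2 fun U hU hKU =>
        mem_nhdsKer.1 hx U hU (nhdsKer_minimal hKU hU))
      subset_nhdsKer

/-- The saturation of a compact Borel set, as a Borel set. -/
def BorelSet.saturation {E : Type*} [TopologicalSpace E] (K : BorelSet E)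
    (hK : IsCompact (K : Set E)) : BorelSet E :=
  ⟨nhdsKer (K : Set E), measurableSet_nhdsKer_of_isCompact hK⟩

end Borel

/-! ### Maxitive measures

All suprema and infima below are expressed by `IsLUB` and `IsGLB`, so that each definition
contains the assertion that the supremum or infimum exists. -/

section Maxitive

variable {E L : Type*} [TopologicalSpace E] [PartialOrder L]

/-- `ν` preserves the supremum of the family `𝒜` of Borel sets whenever the union of `𝒜` is
Borel. -/
def PreservesUnion (ν : BorelSet E → L) (𝒜 : Set (BorelSet E)) : Prop :=
  ∀ B : BorelSet E, (B : Set E) = ⋃ A ∈ 𝒜, (A : Set E) → IsLUB (ν '' 𝒜) (ν B)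

/-- Maxitive measure. -/
def IsMaxitive [OrderBot L] (ν : BorelSet E → L) : Prop :=
  ν (BorelSet.empty E) = ⊥ ∧ ∀ 𝒜 : Set (BorelSet E), 𝒜.Finite → PreservesUnion ν 𝒜

/-- `σ`-maxitive measure. -/
def IsSigmaMaxitive [OrderBot L] (ν : BorelSet E → L) : Prop :=
  ν (BorelSet.empty E) = ⊥ ∧ ∀ 𝒜 : Set (BorelSet E), 𝒜.Countable → PreservesUnion ν 𝒜

/-- Completely maxitive measure. -/
def IsCompletelyMaxitive [OrderBot L] (ν : BorelSet E → L) : Prop :=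
  ν (BorelSet.empty E) = ⊥ ∧ ∀ 𝒜 : Set (BorelSet E), PreservesUnion ν 𝒜

/-- The set of values `ν G`, for `G` open containing `A`. -/
def openValues (ν : BorelSet E → L) (A : Set E) : Set L :=
  {r : L | ∃ G : BorelSet E, IsOpen (G : Set E) ∧ A ⊆ (G : Set E) ∧ r = ν G}

/-- `ν B` is the supremum of the values of `ν` on saturations of compact Borel subsets of `B`,
for all Borel sets `B`. -/
def IsInnerContinuous (ν : BorelSet E → L) : Prop :=
  ∀ B : BorelSet E,
    IsLUB {r : L | ∃ (K : BorelSet E) (hK : IsCompact (K : Set E)),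
      (K : Set E) ⊆ (B : Set E) ∧ r = ν (K.saturation hK)} (ν B)

/-- `ν B` is the infimum of the values of `ν` on open sets containing `B`, for all Borel
sets `B`. -/
def IsOuterContinuous (ν : BorelSet E → L) : Prop :=
  ∀ B : BorelSet E, IsGLB (openValues ν (B : Set E)) (ν B)

/-- Regularity: inner- and outer-continuity. -/
def IsRegularMaxitive (ν : BorelSet E → L) : Prop :=
  IsInnerContinuous ν ∧ IsOuterContinuous ν

/-- `ν G` is the supremum of the values `ν⁺ K` over compact Borel sets `K ⊆ G`, for all open
sets `G`; here `ν⁺ K` is the infimum of the values of `ν` on open sets containing `K` (it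
exists if `ν` is maxitive and `L` is filtered-complete). -/
def IsWeaklyInnerContinuous (ν : BorelSet E → L) : Prop :=
  ∀ G : BorelSet E, IsOpen (G : Set E) →
    IsLUB {r : L | ∃ K : BorelSet E, IsCompact (K : Set E) ∧ (K : Set E) ⊆ (G : Set E) ∧
      IsGLB (openValues ν (K : Set E)) r} (ν G)

/-- `ν K` is the infimum of the values of `ν` on open sets containing `K`, for all compact
Borel sets `K`. -/
def IsWeaklyOuterContinuous (ν : BorelSet E → L) : Prop :=
  ∀ K : BorelSet E, IsCompact (K : Set E) → IsGLB (openValues ν (K : Set E)) (ν K)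

/-- Smoothness with respect to a collection `𝒞` of Borel sets that is closed under filtered
intersections: `ν (⋂ 𝒜)` is the infimum of the values of `ν` on `𝒜`, for all nonempty filtered
`𝒜 ⊆ 𝒞`. -/
def IsSmoothOn (𝒞 : Set (BorelSet E)) (ν : BorelSet E → L) : Prop :=
  ∀ 𝒜 : Set (BorelSet E), 𝒜 ⊆ 𝒞 → 𝒜.Nonempty →
    DirectedOn (fun A B : BorelSet E => (B : Set E) ⊆ (A : Set E)) 𝒜 →
    ∀ Q : BorelSet E, (Q : Set E) = ⋂ A ∈ 𝒜, (A : Set E) → IsGLB (ν '' 𝒜) (ν Q)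

/-- Smoothness with respect to the collection of compact saturated sets. In a quasisober space
this collection is closed under filtered intersections. -/
def IsQSmooth (ν : BorelSet E → L) : Prop :=
  IsSmoothOn {Q : BorelSet E | IsCompact (Q : Set E) ∧ IsSaturatedSet (Q : Set E)} ν

/-- `ν` is saturated if it takes the same value on a compact Borel set and on its
saturation. -/
def IsSaturatedMaxitive (ν : BorelSet E → L) : Prop :=
  ∀ (K : BorelSet E) (hK : IsCompact (K : Set E)), ν K = ν (K.saturation hK)

/-- `c` is a cardinal density of `ν`: `ν B` is the supremum of `c` on `B`, for all Borel
sets `B`. -/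
def IsCardinalDensity (c : E → L) (ν : BorelSet E → L) : Prop :=
  ∀ B : BorelSet E, IsLUB (c '' (B : Set E)) (ν B)

/-- Upper-semicontinuity of a poset-valued map: all sets `{x | t ≫ c x}` are open. -/
def IsUSC (c : E → L) : Prop :=
  ∀ t : L, IsOpen {x : E | WayAbove t (c x)}

/-- `ν` has a cardinal density. -/
def HasCardinalDensity (ν : BorelSet E → L) : Prop :=
  ∃ c : E → L, IsCardinalDensity c ν

/-- `ν` has an upper-semicontinuous cardinal density. -/
def HasUSCCardinalDensity (ν : BorelSet E → L) : Prop :=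
  ∃ c : E → L, IsUSC c ∧ IsCardinalDensity c ν

end Maxitive

open Set Filter Topology MeasureTheory

/-! ### Continuous posets -/

section WayAbove

variable {L : Type*} [PartialOrder L]

/-! The candidate density is c(x) = ν([x]), where [x] is the class of points inseparable from x:
singletons need not be Borel, but every Borel set is a union of such classes. Hence ν has a density
exactly when it is completely maxitive, and then c is one.

For regularity, continuity of L reduces ν B ≤ u to ν B ≤ t for each t ≫ u. If c is usc and bounded
by u on B, then B lies in the open set {t ≫ c}, on which c ≤ t; so it suffices that c determine ν on
open sets (`IsMaxitive.isCardinalDensity_of_isUSC`). The same open sets yield outer-continuity. Weak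
outer-continuity makes c usc and turns pointwise bounds into local ones, which are patched by
compactness and weak inner-continuity, or by the Lindelöf property and σ-maxitivity.

Under 𝒬-smoothness, compact neighbourhoods give back weak outer-continuity of a saturated ν in the
locally compact case; in the metrizable case local bounds come from compact sets shrinking to a
point. Conversely, weak outer-continuity implies 𝒬-smoothness by a Hofmann–Mislove argument,
`exists_subset_of_sInter_subset_of_isSaturatedSet`, where quasisobriety enters. -/

theorem isPFilter_Ici (r : L) : Order.IsPFilter (Ici r) :=
  .of_def ⟨r, le_rfl⟩ (fun _ hx _ hy => ⟨r, le_rfl, hx, hy⟩) fun hxy hx => le_trans hx hxy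

theorem WayAbove.le {s r : L} (h : WayAbove s r) : r ≤ s :=
  h _ r (isPFilter_Ici r) isGLB_Ici le_rfl

theorem WayAbove.mono {s s' r r' : L} (h : WayAbove s r) (hs : s ≤ s') (hr : r' ≤ r) :
    WayAbove s' r' := fun F m hF hm hmr =>
  Order.PFilter.mem_of_le (F := hF.toPFilter) hs (h F m hF hm (hmr.trans hr))

theorem isPFilter_upperClosure {D : Set L} (hne : D.Nonempty) (hD : DirectedOn (· ≥ ·) D) :
    Order.IsPFilter (upperClosure D : Set L) := by
  refine .of_def (hne.mono subset_upperClosure) ?_ fun hxy hx => (upperClosure D).upper hxy hx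
  rintro x ⟨a, ha, hax⟩ y ⟨b, hb, hby⟩
  obtain ⟨d, hd, hda, hdb⟩ := hD a ha b hb
  exact ⟨d, subset_upperClosure hd, hda.trans hax, hdb.trans hby⟩

/-- Filter bases suffice: the upper closure of D is a filter with the same lower bounds as D. -/
theorem WayAbove.exists_le_of_isGLB {s r m : L} (h : WayAbove s r) {D : Set L} (hne : D.Nonempty)
    (hD : DirectedOn (· ≥ ·) D) (hm : IsGLB D m) (hmr : m ≤ r) : ∃ d ∈ D, d ≤ s := by
  refine h (upperClosure D) m (isPFilter_upperClosure hne hD) ?_ hmr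
  rwa [IsGLB, lowerBounds_upperClosure]

theorem IsContinuousPoset.le_of_forall_wayAbove (hL : IsContinuousPoset L) {a u : L}
    (h : ∀ t, WayAbove t u → a ≤ t) : a ≤ u :=
  (hL u).2.2 h

/-- Interpolation: the elements t with t ≫ s ≫ r for some s form a filter with infimum r, so this
filter contains everything way-above r. -/
theorem IsContinuousPoset.exists_wayAbove_between (hL : IsContinuousPoset L) {t r : L}
    (h : WayAbove t r) : ∃ s, WayAbove t s ∧ WayAbove s r := by
  have hdir : ∀ {r a b : L}, WayAbove a r → WayAbove b r → ∃ c, WayAbove c r ∧ c ≤ a ∧ c ≤ b :=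
    fun {r a b} ha hb => (hL r).1.Directed a ha b hb
  have hne : ∀ r : L, ∃ a, WayAbove a r := fun r => (hL r).1.Nonempty
  refine h {t | ∃ s, WayAbove t s ∧ WayAbove s r} r (.of_def ?_ ?_ ?_) ⟨?_, ?_⟩ le_rfl
  · obtain ⟨a, ha⟩ := hne r
    obtain ⟨b, hb⟩ := hne a
    exact ⟨b, a, hb, ha⟩
  · rintro x ⟨a, hxa, ha⟩ y ⟨b, hyb, hb⟩
    obtain ⟨c, hc, hca, hcb⟩ := hdir ha hb
    obtain ⟨z, hz, hzx, hzy⟩ := hdir (hxa.mono le_rfl hca) (hyb.mono le_rfl hcb)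
    exact ⟨z, ⟨c, hz, hc⟩, hzx, hzy⟩
  · rintro x y hxy ⟨a, hxa, ha⟩
    exact ⟨a, hxa.mono hxy le_rfl, ha⟩
  · rintro x ⟨a, hxa, ha⟩
    exact ha.le.trans hxa.le
  · exact fun l hl => hL.le_of_forall_wayAbove fun s hs =>
      hL.le_of_forall_wayAbove fun t ht => hl ⟨s, ht, hs⟩

end WayAbove

/-! ### Borel sets of a space that need not be `T₀` -/

section BorelSets

variable {E : Type*} [TopologicalSpace E]

theorem IsOpen.measurableSet_saturatedBorel {G : Set E} (hG : IsOpen G) :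
    MeasurableSet[saturatedBorel E] G :=
  MeasurableSpace.measurableSet_generateFrom (.inl hG)

theorem IsClosed.measurableSet_saturatedBorel {F : Set E} (hF : IsClosed F) :
    MeasurableSet[saturatedBorel E] F :=
  .of_compl hF.isOpen_compl.measurableSet_saturatedBorel

theorem isSaturatedSet_nhdsKer (A : Set E) : IsSaturatedSet (nhdsKer A) :=
  nhdsKer_nhdsKer A

theorem IsSaturatedSet.mem_of_specializes {A : Set E} (hA : IsSaturatedSet A) {x y : E}
    (h : x ⤳ y) (hy : y ∈ A) : x ∈ A :=
  hA ▸ mem_nhdsKer_iff_specializes.2 ⟨y, hy, h⟩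

theorem isSaturatedSet_of_t1Space [T1Space E] (A : Set E) : IsSaturatedSet A := by
  refine Subset.antisymm (fun x hx => ?_) subset_nhdsKer
  obtain ⟨y, hy, h⟩ := mem_nhdsKer_iff_specializes.1 hx
  rwa [h.eq]

/-- Borel sets do not separate inseparable points. -/
theorem Inseparable.mem_iff_of_measurableSet {x y : E} (h : Inseparable x y) {B : Set E}
    (hB : MeasurableSet[saturatedBorel E] B) : x ∈ B ↔ y ∈ B := by
  induction B, hB using MeasurableSpace.generateFrom_induction with
  | hC t ht =>
    rcases ht with ht | ⟨-, ht⟩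
    · exact h.mem_open_iff ht
    · exact ⟨ht.mem_of_specializes h.specializes', ht.mem_of_specializes h.specializes⟩
  | empty => simp
  | compl t _ ih => exact not_congr ih
  | iUnion s _ ih => simp [ih]

/-- The class of points that are inseparable from `x`: the smallest Borel set containing `x`. -/
def BorelSet.inseparableClass (x : E) : BorelSet E :=
  ⟨nhdsKer {x} ∩ closure {x}, (measurableSet_nhdsKer_of_isCompact isCompact_singleton).inter
    isClosed_closure.measurableSet_saturatedBorel⟩

theorem BorelSet.mem_inseparableClass {x y : E} :
    y ∈ (inseparableClass x : Set E) ↔ Inseparable y x := by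
  change y ∈ nhdsKer {x} ∩ closure {x} ↔ _
  rw [inseparable_iff_specializes_and, mem_inter_iff, mem_nhdsKer_singleton,
    specializes_iff_mem_closure (x := x)]

theorem BorelSet.mem_inseparableClass_self (x : E) : x ∈ (inseparableClass x : Set E) :=
  mem_inseparableClass.2 .rfl

theorem BorelSet.isCompact_inseparableClass (x : E) : IsCompact (inseparableClass x : Set E) :=
  isCompact_singleton.nhdsKer.inter_right isClosed_closure

theorem BorelSet.inseparableClass_subset {B : BorelSet E} {x : E} (hx : x ∈ (B : Set E)) :
    (inseparableClass x : Set E) ⊆ B :=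
  fun _ hy => ((mem_inseparableClass.1 hy).mem_iff_of_measurableSet B.2).2 hx

theorem BorelSet.inseparableClass_eq_singleton [T1Space E] (x : E) :
    (inseparableClass x : Set E) = {x} := by
  ext y
  rw [mem_inseparableClass, inseparable_iff_eq, mem_singleton_iff]

end BorelSets

/-! ### Elementary properties of maxitive measures -/

section OpenValues

variable {E L : Type*} [TopologicalSpace E]

theorem nhdsKer_openValues (ν : BorelSet E → L) (A : Set E) :
    openValues ν (nhdsKer A) = openValues ν A := by
  ext r
  refine exists_congr fun G => and_congr_right fun hG => ?_
  rw [hG.nhdsKer_subset]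

theorem openValues_nonempty (ν : BorelSet E → L) (A : Set E) : (openValues ν A).Nonempty :=
  ⟨_, ⟨univ, .univ⟩, isOpen_univ, subset_univ _, rfl⟩

variable [PartialOrder L] {ν : BorelSet E → L}

theorem IsOuterContinuous.isWeaklyOuterContinuous (h : IsOuterContinuous ν) :
    IsWeaklyOuterContinuous ν := fun K _ => h K

/-- A compact set and its saturation have the same open supersets, hence the same ν⁺. -/
theorem IsWeaklyOuterContinuous.isSaturatedMaxitive (h : IsWeaklyOuterContinuous ν) :
    IsSaturatedMaxitive ν := by
  intro K hK
  have := h (K.saturation hK) hK.nhdsKer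
  rw [BorelSet.saturation, nhdsKer_openValues] at this
  exact (h K hK).unique this

theorem IsRegularMaxitive.isWeaklyInnerContinuous (h : IsRegularMaxitive ν) :
    IsWeaklyInnerContinuous ν := by
  intro G _
  convert h.1 G using 3 with r
  refine exists_congr fun K => ?_
  have hs := h.2.isWeaklyOuterContinuous.isSaturatedMaxitive
  constructor
  · rintro ⟨hK, hKG, hr⟩
    exact ⟨hK, hKG, (hr.unique (h.2 K)).trans (hs K hK)⟩
  · rintro ⟨hK, hKG, rfl⟩
    exact ⟨hK, hKG, hs K hK ▸ h.2 K⟩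

end OpenValues

section Basic

variable {E L : Type*} [TopologicalSpace E] [PartialOrder L] [OrderBot L] {ν : BorelSet E → L}

theorem IsMaxitive.mono (hν : IsMaxitive ν) {A B : BorelSet E}
    (h : (A : Set E) ⊆ B) : ν A ≤ ν B := by
  have := hν.2 {A, B} (by simp) B (by simp [union_eq_self_of_subset_left h])
  exact this.1 (mem_image_of_mem ν (mem_insert _ _))

theorem IsMaxitive.union_le (hν : IsMaxitive ν)
    {A B : BorelSet E} {t : L} (hA : ν A ≤ t) (hB : ν B ≤ t) : ν ⟨A ∪ B, A.2.union B.2⟩ ≤ t := by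
  refine (hν.2 {A, B} (by simp) ⟨A ∪ B, A.2.union B.2⟩ (by simp)).2 ?_
  rintro _ ⟨C, rfl | rfl, rfl⟩ <;> assumption

theorem IsCompletelyMaxitive.isSigmaMaxitive
    (h : IsCompletelyMaxitive ν) : IsSigmaMaxitive ν :=
  ⟨h.1, fun 𝒜 _ => h.2 𝒜⟩

/-- A maxitive measure is bounded by `t` on a compact set if it is so locally. -/
theorem IsMaxitive.le_of_isCompact (hν : IsMaxitive ν)
    {K : BorelSet E} (hK : IsCompact (K : Set E)) {t : L}
    (h : ∀ x ∈ (K : Set E), ∃ A : BorelSet E, (A : Set E) ∈ 𝓝[(K : Set E)] x ∧ ν A ≤ t) :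
    ν K ≤ t := by
  have : ∃ A : BorelSet E, (K : Set E) ⊆ A ∧ ν A ≤ t := by
    -- Compact induction passes through arbitrary subsets, where ν is undefined; hence the Borel
    -- superset in the predicate.
    refine hK.induction_on (p := fun S => ∃ A : BorelSet E, S ⊆ A ∧ ν A ≤ t)
      ⟨.empty E, empty_subset _, hν.1.trans_le bot_le⟩ ?_ ?_ ?_
    · exact fun _ _ hst ⟨A, hA, hAt⟩ => ⟨A, hst.trans hA, hAt⟩
    · exact fun _ _ ⟨A, hA, hAt⟩ ⟨B, hB, hBt⟩ =>
        ⟨⟨A ∪ B, A.2.union B.2⟩, union_subset_union hA hB, hν.union_le hAt hBt⟩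
    · intro x hx
      obtain ⟨A, hA, hAt⟩ := h x hx
      exact ⟨A, hA, A, Subset.rfl, hAt⟩
  obtain ⟨A, hA, hAt⟩ := this
  exact (hν.mono hA).trans hAt

/-- A `σ`-maxitive measure is bounded by `t` on the union of countably many Borel sets if it is
so on each of them. -/
theorem IsSigmaMaxitive.le_of_eq_sUnion (hν : IsSigmaMaxitive ν)
    {𝒜 : Set (BorelSet E)} (hc : 𝒜.Countable) {B : BorelSet E}
    (hB : (B : Set E) = ⋃ A ∈ 𝒜, (A : Set E)) {t : L} (h : ∀ A ∈ 𝒜, ν A ≤ t) : ν B ≤ t :=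
  (hν.2 𝒜 hc B hB).2 (forall_mem_image.2 h)

theorem IsMaxitive.directedOn_openValues (hν : IsMaxitive ν)
    (A : Set E) : DirectedOn (· ≥ ·) (openValues ν A) := by
  rintro _ ⟨G, hG, hAG, rfl⟩ _ ⟨H, hH, hAH, rfl⟩
  exact ⟨_, ⟨⟨G ∩ H, G.2.inter H.2⟩, hG.inter hH, subset_inter hAG hAH, rfl⟩,
    hν.mono inter_subset_left, hν.mono inter_subset_right⟩

theorem IsMaxitive.mem_lowerBounds_openValues (hν : IsMaxitive ν)
    (B : BorelSet E) : ν B ∈ lowerBounds (openValues ν B) := by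
  rintro _ ⟨G, -, hBG, rfl⟩
  exact hν.mono hBG

theorem IsMaxitive.exists_isOpen_of_wayAbove (hν : IsMaxitive ν)
    {A : Set E} {m t : L} (hm : IsGLB (openValues ν A) m) (ht : WayAbove t m) :
    ∃ G : BorelSet E, IsOpen (G : Set E) ∧ A ⊆ G ∧ ν G ≤ t := by
  obtain ⟨_, ⟨G, hG, hAG, rfl⟩, hGt⟩ := ht.exists_le_of_isGLB (openValues_nonempty ν A)
    (hν.directedOn_openValues A) hm le_rfl
  exact ⟨G, hG, hAG, hGt⟩

/-- In a continuous poset, smoothness bounds the measure of some member of a filtered family. -/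
theorem IsSmoothOn.exists_le_of_wayAbove (hν : IsMaxitive ν)
    {𝒞 𝒜 : Set (BorelSet E)} (h : IsSmoothOn 𝒞 ν) (h𝒜 : 𝒜 ⊆ 𝒞) (hne : 𝒜.Nonempty)
    (hdir : DirectedOn (fun A B : BorelSet E => (B : Set E) ⊆ (A : Set E)) 𝒜) {Q : BorelSet E}
    (hQ : (Q : Set E) = ⋂ A ∈ 𝒜, (A : Set E)) {t : L} (ht : WayAbove t (ν Q)) :
    ∃ A ∈ 𝒜, ν A ≤ t := by
  have hν𝒜 : DirectedOn (· ≥ ·) (ν '' 𝒜) := by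
    rintro _ ⟨A, hA, rfl⟩ _ ⟨B, hB, rfl⟩
    obtain ⟨C, hC, hCA, hCB⟩ := hdir A hA B hB
    exact ⟨_, mem_image_of_mem ν hC, hν.mono hCA, hν.mono hCB⟩
  obtain ⟨_, ⟨A, hA, rfl⟩, hAt⟩ := ht.exists_le_of_isGLB (hne.image ν) hν𝒜
    (h 𝒜 h𝒜 hne hdir Q hQ) le_rfl
  exact ⟨A, hA, hAt⟩

end Basic

/-! ### Cardinal densities -/

section Density

variable {E L : Type*} [TopologicalSpace E] [PartialOrder L] [OrderBot L] {ν : BorelSet E → L}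

theorem IsCardinalDensity.isCompletelyMaxitive {c : E → L} (hc : IsCardinalDensity c ν) :
    IsCompletelyMaxitive ν := by
  refine ⟨?_, fun 𝒜 B hB => ⟨?_, fun u hu => (hc B).2 ?_⟩⟩
  · exact le_bot_iff.1 ((hc (.empty E)).2 (forall_mem_image.2 fun x hx => hx.elim))
  · refine forall_mem_image.2 fun A hA => (hc A).2 (forall_mem_image.2 fun x hx => ?_)
    exact (hc B).1 (mem_image_of_mem c (hB ▸ mem_biUnion hA hx))
  · refine forall_mem_image.2 fun x hx => ?_
    rw [hB] at hx
    obtain ⟨A, hA, hxA⟩ := mem_iUnion₂.1 hx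
    exact ((hc A).1 (mem_image_of_mem c hxA)).trans (hu (mem_image_of_mem ν hA))

theorem IsCompletelyMaxitive.isCardinalDensity (h : IsCompletelyMaxitive ν) :
    IsCardinalDensity (fun x => ν (.inseparableClass x)) ν := by
  intro B
  have := h.2 (BorelSet.inseparableClass '' (B : Set E)) B ?_
  · rwa [image_image] at this
  · rw [biUnion_image]
    exact Subset.antisymm (fun x hx => mem_biUnion hx (BorelSet.mem_inseparableClass_self x))
      (iUnion₂_subset fun x hx => BorelSet.inseparableClass_subset hx)

theorem hasCardinalDensity_iff_isCompletelyMaxitive :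
    HasCardinalDensity ν ↔ IsCompletelyMaxitive ν :=
  ⟨fun ⟨_, hc⟩ => hc.isCompletelyMaxitive, fun h => ⟨_, h.isCardinalDensity⟩⟩

/-- A usc map that determines a maxitive measure on open sets is a cardinal density. -/
theorem IsMaxitive.isCardinalDensity_of_isUSC (hL : IsContinuousPoset L) (hν : IsMaxitive ν)
    (husc : IsUSC fun x => ν (.inseparableClass x))
    (hopen : ∀ G : BorelSet E, IsOpen (G : Set E) → ∀ u : L,
      (∀ x ∈ (G : Set E), ν (.inseparableClass x) ≤ u) → ν G ≤ u) :
    IsCardinalDensity (fun x => ν (.inseparableClass x)) ν := by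
  refine fun B => ⟨forall_mem_image.2 fun x hx => hν.mono (BorelSet.inseparableClass_subset hx),
    fun u hu => hL.le_of_forall_wayAbove fun t ht => ?_⟩
  -- B is enlarged to the open set {t ≫ c}, on which c ≤ t.
  refine (hν.mono (B := ⟨_, (husc t).measurableSet_saturatedBorel⟩) fun x hx => ?_).trans
    (hopen ⟨_, (husc t).measurableSet_saturatedBorel⟩ (husc t) t fun x hx => WayAbove.le hx)
  exact ht.mono le_rfl (hu (mem_image_of_mem _ hx))

/-- Interpolate t ≫ s ≫ c(x): some open set around x has measure at most s, so c ≤ s there and t ≫ c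
persists. -/
theorem IsWeaklyOuterContinuous.isUSC (hL : IsContinuousPoset L) (hν : IsMaxitive ν)
    (h : IsWeaklyOuterContinuous ν) : IsUSC fun x => ν (.inseparableClass x) := by
  refine fun t => isOpen_iff_mem_nhds.2 fun x hx => ?_
  obtain ⟨s, hts, hs⟩ := hL.exists_wayAbove_between hx
  obtain ⟨G, hG, hxG, hGs⟩ := hν.exists_isOpen_of_wayAbove
    (h _ (BorelSet.isCompact_inseparableClass x)) hs
  refine mem_of_superset (hG.mem_nhds (hxG (BorelSet.mem_inseparableClass_self x))) fun y hy => ?_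
  exact hts.mono le_rfl ((hν.mono (BorelSet.inseparableClass_subset hy)).trans hGs)

theorem IsWeaklyOuterContinuous.exists_mem_nhds_le (hν : IsMaxitive ν)
    (h : IsWeaklyOuterContinuous ν) {x : E} {t u : L} (hu : ν (.inseparableClass x) ≤ u)
    (ht : WayAbove t u) : ∃ G : BorelSet E, (G : Set E) ∈ 𝓝 x ∧ ν G ≤ t := by
  obtain ⟨G, hG, hxG, hGt⟩ := hν.exists_isOpen_of_wayAbove
    (h _ (BorelSet.isCompact_inseparableClass x)) (ht.mono le_rfl hu)
  exact ⟨G, hG.mem_nhds (hxG (BorelSet.mem_inseparableClass_self x)), hGt⟩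

theorem IsWeaklyOuterContinuous.le_of_isCompact (hL : IsContinuousPoset L) (hν : IsMaxitive ν)
    (h : IsWeaklyOuterContinuous ν) {K : BorelSet E} (hK : IsCompact (K : Set E)) {u : L}
    (hu : ∀ x ∈ (K : Set E), ν (.inseparableClass x) ≤ u) : ν K ≤ u := by
  refine hL.le_of_forall_wayAbove fun t ht => hν.le_of_isCompact hK fun x hx => ?_
  obtain ⟨G, hG, hGt⟩ := h.exists_mem_nhds_le hν (hu x hx) ht
  exact ⟨G, mem_nhdsWithin_of_mem_nhds hG, hGt⟩

theorem IsWeaklyInnerContinuous.hasUSCCardinalDensity (hL : IsContinuousPoset L)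
    (hν : IsMaxitive ν) (hi : IsWeaklyInnerContinuous ν) (ho : IsWeaklyOuterContinuous ν) :
    HasUSCCardinalDensity ν := by
  refine ⟨_, ho.isUSC hL hν, hν.isCardinalDensity_of_isUSC hL (ho.isUSC hL hν) fun G hG u hu => ?_⟩
  refine (hi G hG).2 ?_
  rintro _ ⟨K, hK, hKG, hr⟩
  rw [hr.unique (ho K hK)]
  exact ho.le_of_isCompact hL hν hK fun x hx => hu x (hKG hx)

/-- For t ≫ ν B, the open set {t ≫ c} contains B and has measure at most t. -/
theorem IsCardinalDensity.isOuterContinuous (hL : IsContinuousPoset L) (hν : IsMaxitive ν)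
    {c : E → L} (husc : IsUSC c) (hc : IsCardinalDensity c ν) : IsOuterContinuous ν := by
  refine fun B => ⟨hν.mem_lowerBounds_openValues B, fun l hl =>
    hL.le_of_forall_wayAbove fun t ht => ?_⟩
  refine (hl ⟨⟨_, (husc t).measurableSet_saturatedBorel⟩, husc t, fun x hx => ?_, rfl⟩).trans
    ((hc _).2 (forall_mem_image.2 fun x hx => WayAbove.le hx))
  exact ht.mono le_rfl ((hc B).1 (mem_image_of_mem c hx))

/-- The inseparability classes of the points of B are compact Borel subsets of B, and they already
exhaust the supremum. -/
theorem IsCompletelyMaxitive.isInnerContinuous (hν : IsMaxitive ν) (h : IsCompletelyMaxitive ν)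
    (hs : IsSaturatedMaxitive ν) : IsInnerContinuous ν := by
  refine fun B => ⟨?_, fun u hu => (h.isCardinalDensity B).2 (forall_mem_image.2 fun x hx => ?_)⟩
  · rintro _ ⟨K, hK, hKB, rfl⟩
    exact (hs K hK).symm.trans_le (hν.mono hKB)
  · exact hu ⟨_, BorelSet.isCompact_inseparableClass x, BorelSet.inseparableClass_subset hx,
      hs _ _⟩

theorem IsMaxitive.regular_tfae (hL : IsContinuousPoset L) (hν : IsMaxitive ν) :
    [IsRegularMaxitive ν,
      HasUSCCardinalDensity ν,
      IsOuterContinuous ν ∧ IsCompletelyMaxitive ν,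
      IsWeaklyOuterContinuous ν ∧ IsWeaklyInnerContinuous ν].TFAE := by
  tfae_have 1 → 4 := fun h => ⟨h.2.isWeaklyOuterContinuous, h.isWeaklyInnerContinuous⟩
  tfae_have 4 → 2 := fun h => h.2.hasUSCCardinalDensity hL hν h.1
  tfae_have 2 → 3 := fun ⟨_, husc, hc⟩ =>
    ⟨hc.isOuterContinuous hL hν husc, hc.isCompletelyMaxitive⟩
  tfae_have 3 → 1 := fun h =>
    ⟨h.2.isInnerContinuous hν h.1.isWeaklyOuterContinuous.isSaturatedMaxitive, h.1⟩
  tfae_finish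

/-- Open sets are Lindelöf, so the local bounds on ν are patched along a countable cover. -/
theorem IsWeaklyOuterContinuous.hasUSCCardinalDensity [HereditarilyLindelofSpace E]
    (hL : IsContinuousPoset L) (hν : IsMaxitive ν) (h : IsWeaklyOuterContinuous ν)
    (hσ : IsSigmaMaxitive ν) : HasUSCCardinalDensity ν := by
  refine ⟨_, h.isUSC hL hν, hν.isCardinalDensity_of_isUSC hL (h.isUSC hL hν) fun G _ u hu => ?_⟩
  refine hL.le_of_forall_wayAbove fun t ht => ?_
  have : ∃ A : BorelSet E, (G : Set E) ⊆ A ∧ ν A ≤ t := by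
    refine (HereditarilyLindelofSpace.isLindelof (G : Set E)).induction_on
      (p := fun S => ∃ A : BorelSet E, S ⊆ A ∧ ν A ≤ t) ?_ ?_ ?_
    · exact fun _ _ hst ⟨A, hA, hAt⟩ => ⟨A, hst.trans hA, hAt⟩
    · intro S hS hA
      choose! A hSA hAt using hA
      refine ⟨⟨⋃ B ∈ A '' S, (B : Set E), .biUnion (hS.image A) fun B _ => B.2⟩, ?_,
        hσ.le_of_eq_sUnion (hS.image A) rfl (forall_mem_image.2 hAt)⟩
      exact sUnion_subset fun T hT =>
        (hSA T hT).trans (subset_biUnion_of_mem (u := fun B : BorelSet E => (B : Set E))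
          (mem_image_of_mem A hT))
    · intro x hx
      obtain ⟨A, hA, hAt⟩ := h.exists_mem_nhds_le hν (hu x hx) ht
      exact ⟨A, mem_nhdsWithin_of_mem_nhds hA, A, Subset.rfl, hAt⟩
  obtain ⟨A, hA, hAt⟩ := this
  exact (hν.mono hA).trans hAt

end Density

/-! ### Filtered families of compact saturated sets -/

section Smooth

variable {E : Type*} [TopologicalSpace E]

/-- In a quasisober space, if an open set contains the intersection of a filtered family of
compact saturated sets, then it contains a member of the family. -/
theorem exists_subset_of_sInter_subset_of_isSaturatedSet [QuasiSober E] {𝒬 : Set (Set E)}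
    (hne : 𝒬.Nonempty) (hdir : DirectedOn (· ⊇ ·) 𝒬) (hc : ∀ Q ∈ 𝒬, IsCompact Q)
    (hs : ∀ Q ∈ 𝒬, IsSaturatedSet Q) {G : Set E} (hG : IsOpen G) (h : ⋂₀ 𝒬 ⊆ G) :
    ∃ Q ∈ 𝒬, Q ⊆ G := by
  by_contra! hcon
  -- If no member lies in G, then Gᶜ is a closed set meeting every member. A minimal such set inside
  -- Gᶜ will be irreducible, and its generic point will lie in ⋂₀ 𝒬 but outside G.
  let S : Set (Set E) := {C | IsClosed C ∧ ∀ Q ∈ 𝒬, (Q ∩ C).Nonempty}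
  have hGS : Gᶜ ∈ S := ⟨hG.isClosed_compl, fun Q hQ => by
    simpa [inter_compl_nonempty_iff] using hcon Q hQ⟩
  obtain ⟨C, hCG, hC⟩ := zorn_superset_nonempty S (fun c hcS hchain hcne => by
    refine ⟨⋂₀ c, ⟨isClosed_sInter fun C hC => (hcS hC).1, fun Q hQ => ?_⟩,
      fun C hC => sInter_subset_of_mem hC⟩
    rw [sInter_eq_iInter]
    have := hcne.to_subtype
    -- Chains have lower bounds in S because each Q is compact.
    refine (hc Q hQ).inter_iInter_nonempty _ (fun C => (hcS C.2).1) fun s => ?_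
    have hdirc : DirectedOn (· ⊇ ·) c := fun A hA B hB =>
      (hchain.total hA hB).elim (fun h => ⟨A, hA, Subset.rfl, h⟩) fun h => ⟨B, hB, h, Subset.rfl⟩
    obtain ⟨D, hD⟩ := (directedOn_iff_directed.1 hdirc).finset_le s
    exact ((hcS D.2).2 Q hQ).mono (inter_subset_inter_right _ (subset_iInter₂ hD))) Gᶜ hGS
  obtain ⟨⟨hCc, hCQ⟩, hmin⟩ := hC
  have hirr : IsIrreducible C := by
    refine ⟨?_, isPreirreducible_iff_isClosed_union_isClosed.2 fun A B hA hB hAB => ?_⟩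
    · obtain ⟨Q, hQ⟩ := hne
      exact (hCQ Q hQ).mono inter_subset_right
    by_contra! hnot
    -- By minimality, a closed set not containing C has a trace on C that some member of 𝒬 misses.
    have key : ∀ A : Set E, IsClosed A → ¬ C ⊆ A → ∃ Q ∈ 𝒬, Q ∩ (C ∩ A) = ∅ := by
      intro A hA hCA
      by_contra! hcon
      exact hCA ((hmin ⟨hCc.inter hA, hcon⟩ inter_subset_left).trans inter_subset_right)
    obtain ⟨Q, hQ, hQA⟩ := key A hA hnot.1
    obtain ⟨R, hR, hRB⟩ := key B hB hnot.2
    obtain ⟨T, hT, hTQ, hTR⟩ := hdir Q hQ R hR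
    obtain ⟨x, hxT, hxC⟩ := hCQ T hT
    rcases hAB hxC with hx | hx
    · exact (hQA ▸ (⟨hTQ hxT, hxC, hx⟩ : x ∈ Q ∩ (C ∩ A)) : x ∈ (∅ : Set E))
    · exact (hRB ▸ (⟨hTR hxT, hxC, hx⟩ : x ∈ R ∩ (C ∩ B)) : x ∈ (∅ : Set E))
  obtain ⟨x, hx⟩ := QuasiSober.sober hirr hCc
  refine hCG hx.mem (h (mem_sInter.2 fun Q hQ => ?_))
  obtain ⟨y, hyQ, hyC⟩ := hCQ Q hQ
  -- The generic point x specializes to a point of Q ∩ C, and Q is saturated.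
  exact (hs Q hQ).mem_of_specializes (hx.specializes hyC) hyQ

/-- An open cover of the intersection already covers some member, which is compact. -/
theorem isCompact_sInter_of_isSaturatedSet [QuasiSober E] {𝒬 : Set (Set E)}
    (hne : 𝒬.Nonempty) (hdir : DirectedOn (· ⊇ ·) 𝒬) (hc : ∀ Q ∈ 𝒬, IsCompact Q)
    (hs : ∀ Q ∈ 𝒬, IsSaturatedSet Q) : IsCompact (⋂₀ 𝒬) := by
  refine isCompact_of_finite_subcover fun U hU hcov => ?_
  obtain ⟨Q, hQ, hQU⟩ := exists_subset_of_sInter_subset_of_isSaturatedSet hne hdir hc hs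
    (isOpen_iUnion hU) hcov
  obtain ⟨t, ht⟩ := (hc Q hQ).elim_finite_subcover U hU hQU
  exact ⟨t, (sInter_subset_of_mem hQ).trans ht⟩

variable {L : Type*} [PartialOrder L] [OrderBot L] {ν : BorelSet E → L}

/-- Every open set around the intersection contains a member of the family, so a lower bound of ν on
the family is one on these open sets. -/
theorem IsWeaklyOuterContinuous.isQSmooth [QuasiSober E] (hν : IsMaxitive ν)
    (h : IsWeaklyOuterContinuous ν) : IsQSmooth ν := by
  intro 𝒜 h𝒜 hne hdir Q hQ
  have hdir' : DirectedOn (· ⊇ ·) (Subtype.val '' 𝒜) := by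
    rintro _ ⟨A, hA, rfl⟩ _ ⟨B, hB, rfl⟩
    obtain ⟨C, hC, hCA, hCB⟩ := hdir A hA B hB
    exact ⟨_, mem_image_of_mem _ hC, hCA, hCB⟩
  have hc : ∀ A ∈ Subtype.val '' 𝒜, IsCompact A := forall_mem_image.2 fun A hA => (h𝒜 hA).1
  have hs : ∀ A ∈ Subtype.val '' 𝒜, IsSaturatedSet A := forall_mem_image.2 fun A hA => (h𝒜 hA).2
  rw [← sInter_image] at hQ
  have hQc : IsCompact (Q : Set E) :=
    hQ ▸ isCompact_sInter_of_isSaturatedSet (hne.image _) hdir' hc hs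
  refine ⟨forall_mem_image.2 fun A hA => hν.mono ?_, fun l hl => (h Q hQc).2 ?_⟩
  · exact hQ ▸ sInter_subset_of_mem (mem_image_of_mem _ hA)
  · rintro _ ⟨G, hG, hQG, rfl⟩
    obtain ⟨_, ⟨A, hA, rfl⟩, hAG⟩ := exists_subset_of_sInter_subset_of_isSaturatedSet
      (hne.image _) hdir' hc hs hG (hQ ▸ hQG)
    exact (hl (mem_image_of_mem ν hA)).trans (hν.mono hAG)

/-- The compact saturated neighbourhoods of K form a filtered family with intersection ↑K, and each
has an open set around K in its interior. -/
theorem IsQSmooth.isWeaklyOuterContinuous [LocallyCompactSpace E] (hν : IsMaxitive ν)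
    (h : IsQSmooth ν) (hs : IsSaturatedMaxitive ν) : IsWeaklyOuterContinuous ν := by
  refine fun K hK => ⟨hν.mem_lowerBounds_openValues K, fun l hl => ?_⟩
  let 𝒜 : Set (BorelSet E) := {Q | IsCompact (Q : Set E) ∧ IsSaturatedSet (Q : Set E) ∧
    (K : Set E) ⊆ interior (Q : Set E)}
  have key : ∀ G : Set E, IsOpen G → (K : Set E) ⊆ G → ∃ Q ∈ 𝒜, (Q : Set E) ⊆ G := by
    intro G hG hKG
    obtain ⟨C, hC, hKC, hCG⟩ := exists_compact_between hK hG hKG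
    exact ⟨⟨nhdsKer C, measurableSet_nhdsKer_of_isCompact hC⟩, ⟨hC.nhdsKer,
      isSaturatedSet_nhdsKer C, hKC.trans (interior_mono subset_nhdsKer)⟩, nhdsKer_minimal hCG hG⟩
  have hglb := h 𝒜 (fun Q hQ => ⟨hQ.1, hQ.2.1⟩)
    (let ⟨Q, hQ, _⟩ := key univ isOpen_univ (subset_univ _); ⟨Q, hQ⟩) ?_ (K.saturation hK) ?_
  · rw [hs K hK]
    refine hglb.2 (forall_mem_image.2 fun Q hQ => ?_)
    exact (hl ⟨⟨_, isOpen_interior.measurableSet_saturatedBorel⟩, isOpen_interior, hQ.2.2,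
      rfl⟩).trans (hν.mono interior_subset)
  · rintro A hA B hB
    obtain ⟨Q, hQ, hQAB⟩ := key (interior (A : Set E) ∩ interior (B : Set E))
      (isOpen_interior.inter isOpen_interior) (subset_inter hA.2.2 hB.2.2)
    exact ⟨Q, hQ, hQAB.trans (inter_subset_left.trans interior_subset),
      hQAB.trans (inter_subset_right.trans interior_subset)⟩
  · refine Subset.antisymm (subset_iInter₂ fun Q hQ => ?_) fun x hx => mem_nhdsKer.2 fun G hG hKG =>
      ?_
    · exact (nhdsKer_mono (hQ.2.2.trans interior_subset)).trans hQ.2.1.subset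
    · obtain ⟨Q, hQ, hQG⟩ := key G hG hKG
      exact hQG (mem_iInter₂.1 hx Q hQ)

end Smooth

/-! ### Metrizable spaces -/

section Metrizable

open TopologicalSpace

variable {E L : Type*} [TopologicalSpace E] [MetrizableSpace E] [PartialOrder L] [OrderBot L]
  {ν : BorelSet E → L}

theorem IsCompact.measurableSet_saturatedBorel {K : Set E} (hK : IsCompact K) :
    MeasurableSet[saturatedBorel E] K :=
  hK.isClosed.measurableSet_saturatedBorel

/-- The form of 𝒬-smoothness used below: every set is saturated in a T₁ space, so it applies to
compact sets shrinking to a point. -/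
theorem IsQSmooth.exists_compact_le {ι : Type*} [Nonempty ι] [Preorder ι] [IsDirectedOrder ι]
    (hν : IsMaxitive ν) (h : IsQSmooth ν) {K : ι → BorelSet E}
    (hanti : Antitone fun i => (K i : Set E))
    (hK : ∀ i, IsCompact (K i : Set E)) {x : E} (hx : ⋂ i, (K i : Set E) = {x}) {t : L}
    (ht : WayAbove t (ν (.inseparableClass x))) : ∃ i, ν (K i) ≤ t := by
  rw [← exists_range_iff (p := fun A => ν A ≤ t)]
  refine IsSmoothOn.exists_le_of_wayAbove hν h ?_ (range_nonempty K) ?_ ?_ ht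
  · rintro _ ⟨i, rfl⟩
    exact ⟨hK i, isSaturatedSet_of_t1Space _⟩
  · rintro _ ⟨i, rfl⟩ _ ⟨j, rfl⟩
    obtain ⟨k, hik, hjk⟩ := exists_ge_ge i j
    exact ⟨_, mem_range_self k, hanti hik, hanti hjk⟩
  · rw [BorelSet.inseparableClass_eq_singleton, biInter_range, hx]

/-- Points need not have compact neighbourhoods, so sequences replace them: if u n → x with t ≫ c
failing at every u n, the tails of u together with x are compact and shrink to {x}, so some tail has
measure at most s, where t ≫ s ≫ c(x). -/
theorem IsQSmooth.isUSC (hL : IsContinuousPoset L) (hν : IsMaxitive ν) (h : IsQSmooth ν) :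
    IsUSC fun x => ν (.inseparableClass x) := by
  refine fun t => isOpen_iff_mem_nhds.2 fun x hx => ?_
  by_contra hcon
  rw [← mem_interior_iff_mem_nhds, ← notMem_compl_iff, not_not, ← closure_compl,
    mem_closure_iff_seq_limit] at hcon
  obtain ⟨u, hu, hux⟩ := hcon
  obtain ⟨s, hts, hs⟩ := hL.exists_wayAbove_between hx
  have hK : ∀ m, IsCompact (insert x (range fun n => u (n + m))) := fun m =>
    ((tendsto_add_atTop_iff_nat m).2 hux).isCompact_insert_range
  suffices ∃ m, ν ⟨_, (hK m).measurableSet_saturatedBorel⟩ ≤ s by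
    obtain ⟨m, hm⟩ := this
    refine hu m (hts.mono le_rfl ((hν.mono (BorelSet.inseparableClass_subset ?_)).trans hm))
    exact .inr ⟨0, by simp⟩
  refine h.exists_compact_le hν
    (K := fun m => ⟨insert x (range fun n => u (n + m)), (hK m).measurableSet_saturatedBorel⟩)
    ?_ hK ?_ hs
  · refine antitone_nat_of_succ_le fun m => insert_subset_insert ?_
    rintro _ ⟨n, rfl⟩
    exact ⟨n + 1, congrArg u (by omega)⟩
  · refine Subset.antisymm (fun y hy => ?_) (singleton_subset_iff.2 (mem_iInter.2 fun m => .inl rfl))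
    by_contra hyx
    obtain ⟨m, hm⟩ := eventually_atTop.1 (hux.eventually_ne (Ne.symm hyx))
    rcases mem_iInter.1 hy m with rfl | ⟨n, rfl⟩
    · exact hyx rfl
    · exact hm (n + m) (by omega) rfl

/-- Traces on K of closed balls around x are compact, shrink to {x}, and are neighbourhoods of x
within K, so they give the local bounds. -/
theorem IsQSmooth.le_of_isCompact (hL : IsContinuousPoset L) (hν : IsMaxitive ν) (h : IsQSmooth ν)
    {K : BorelSet E} (hK : IsCompact (K : Set E)) {u : L}
    (hu : ∀ x ∈ (K : Set E), ν (.inseparableClass x) ≤ u) : ν K ≤ u := by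
  let := metrizableSpaceMetric E
  refine hL.le_of_forall_wayAbove fun t ht => hν.le_of_isCompact hK fun x hx => ?_
  have hc : ∀ n : ℕ, IsCompact ((K : Set E) ∩ Metric.closedBall x (1 / (n + 1))) := fun n =>
    hK.inter_right Metric.isClosed_closedBall
  suffices ∃ n, ν ⟨_, (hc n).measurableSet_saturatedBorel⟩ ≤ t by
    obtain ⟨n, hn⟩ := this
    exact ⟨_, inter_mem self_mem_nhdsWithin
      (mem_nhdsWithin_of_mem_nhds (Metric.closedBall_mem_nhds x Nat.one_div_pos_of_nat)), hn⟩
  refine h.exists_compact_le hν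
    (K := fun n => ⟨_, (hc n).measurableSet_saturatedBorel⟩) ?_ hc ?_ (ht.mono le_rfl (hu x hx))
  · exact fun m n hmn => inter_subset_inter_right _
      (Metric.closedBall_subset_closedBall (Nat.one_div_le_one_div hmn))
  · refine Subset.antisymm (fun y hy => ?_) (singleton_subset_iff.2 (mem_iInter.2 fun m =>
      ⟨hx, Metric.mem_closedBall_self Nat.one_div_pos_of_nat.le⟩))
    refine dist_le_zero.1 (ge_of_tendsto' tendsto_one_div_add_atTop_nhds_zero_nat fun n => ?_)
    exact (mem_iInter.1 hy n).2

/-- An open set is an Fσ, and by σ-compactness a countable union of compact sets; σ-maxitivity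
reduces the bound to these. -/
theorem IsQSmooth.hasUSCCardinalDensity [SigmaCompactSpace E] (hL : IsContinuousPoset L)
    (hν : IsMaxitive ν) (h : IsQSmooth ν) (hσ : IsSigmaMaxitive ν) : HasUSCCardinalDensity ν := by
  refine ⟨_, h.isUSC hL hν, hν.isCardinalDensity_of_isUSC hL (h.isUSC hL hν) fun G hG u hu => ?_⟩
  let := metrizableSpaceMetric E
  obtain ⟨F, hF, -, hFG, -⟩ := hG.exists_iUnion_isClosed
  have hc : ∀ p : ℕ × ℕ, IsCompact (compactCovering E p.1 ∩ F p.2) := fun p =>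
    (isCompact_compactCovering E p.1).inter_right (hF p.2)
  refine hσ.le_of_eq_sUnion
    (countable_range fun p : ℕ × ℕ => (⟨_, (hc p).measurableSet_saturatedBorel⟩ : BorelSet E))
    ?_ (forall_mem_range.2 fun p => h.le_of_isCompact hL hν (hc p) fun x hx => hu x ?_)
  · rw [biUnion_range, ← hFG]
    ext x
    simp only [mem_iUnion, mem_inter_iff, Prod.exists]
    exact ⟨fun ⟨j, hj⟩ => let ⟨i, hi⟩ := exists_mem_compactCovering x; ⟨i, j, hi, hj⟩,
      fun ⟨_, j, _, hj⟩ => ⟨j, hj⟩⟩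
  · exact hFG ▸ mem_iUnion_of_mem p.2 hx.2

end Metrizable

theorem mainTheorem1 {E : Type*} [TopologicalSpace E] [QuasiSober E]
    {L : Type*} [PartialOrder L] [OrderBot L] (hL : IsFilteredDomain L)
    (ν : BorelSet E → L) (hν : IsMaxitive ν) :
    (HasCardinalDensity ν ↔ IsCompletelyMaxitive ν) ∧
    [IsRegularMaxitive ν,
        HasUSCCardinalDensity ν,
        IsOuterContinuous ν ∧ IsCompletelyMaxitive ν,
        IsWeaklyOuterContinuous ν ∧ IsWeaklyInnerContinuous ν].TFAE ∧
    (IsWeaklyOuterContinuous ν ∧ IsWeaklyInnerContinuous ν →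
      IsWeaklyOuterContinuous ν ∧ IsSigmaMaxitive ν) ∧
    (IsWeaklyOuterContinuous ν ∧ IsSigmaMaxitive ν →
      IsWeaklyOuterContinuous ν) ∧
    (IsWeaklyOuterContinuous ν →
      IsQSmooth ν ∧ IsSaturatedMaxitive ν) ∧
    (IsQSmooth ν ∧ IsWeaklyInnerContinuous ν ∧ IsSaturatedMaxitive ν →
      IsQSmooth ν ∧ IsSaturatedMaxitive ν) ∧
    (SecondCountableTopology E →
      [IsRegularMaxitive ν,
        HasUSCCardinalDensity ν,
        IsOuterContinuous ν ∧ IsCompletelyMaxitive ν,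
        IsWeaklyOuterContinuous ν ∧ IsWeaklyInnerContinuous ν,
        IsWeaklyOuterContinuous ν ∧ IsSigmaMaxitive ν].TFAE) ∧
    (LocallyCompactSpace E →
      [IsQSmooth ν ∧ IsWeaklyInnerContinuous ν ∧ IsSaturatedMaxitive ν,
        IsRegularMaxitive ν,
        HasUSCCardinalDensity ν,
        IsOuterContinuous ν ∧ IsCompletelyMaxitive ν,
        IsWeaklyOuterContinuous ν ∧ IsWeaklyInnerContinuous ν].TFAE ∧
      (IsWeaklyOuterContinuous ν ↔ IsQSmooth ν ∧ IsSaturatedMaxitive ν)) ∧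
    (SigmaCompactSpace E → TopologicalSpace.MetrizableSpace E →
      [IsQSmooth ν ∧ IsSigmaMaxitive ν ∧ IsSaturatedMaxitive ν,
        IsRegularMaxitive ν,
        HasUSCCardinalDensity ν,
        IsOuterContinuous ν ∧ IsCompletelyMaxitive ν,
        IsWeaklyOuterContinuous ν ∧ IsWeaklyInnerContinuous ν,
        IsWeaklyOuterContinuous ν ∧ IsSigmaMaxitive ν].TFAE) ∧
    (LocallyCompactSpace E → PolishSpace E →
      [IsQSmooth ν ∧ IsWeaklyInnerContinuous ν ∧ IsSaturatedMaxitive ν,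
        IsQSmooth ν ∧ IsSigmaMaxitive ν ∧ IsSaturatedMaxitive ν,
        IsRegularMaxitive ν,
        HasUSCCardinalDensity ν,
        IsOuterContinuous ν ∧ IsCompletelyMaxitive ν,
        IsWeaklyOuterContinuous ν ∧ IsWeaklyInnerContinuous ν,
        IsWeaklyOuterContinuous ν ∧ IsSigmaMaxitive ν].TFAE ∧
      (IsWeaklyOuterContinuous ν ↔ IsQSmooth ν ∧ IsSaturatedMaxitive ν)) := by
  have hc := hL.2
  have reg := hν.regular_tfae hc
  have e12 := reg.out 0 1
  have e13 := reg.out 0 2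
  have e14 := reg.out 0 3
  have e34 := reg.out 2 3
  have h45 : IsWeaklyOuterContinuous ν ∧ IsWeaklyInnerContinuous ν →
      IsWeaklyOuterContinuous ν ∧ IsSigmaMaxitive ν := fun h =>
    ⟨h.1, (e34.2 h).2.isSigmaMaxitive⟩
  have h67 : IsWeaklyOuterContinuous ν → IsQSmooth ν ∧ IsSaturatedMaxitive ν := fun h =>
    ⟨h.isQSmooth hν, h.isSaturatedMaxitive⟩
  have h48 : IsWeaklyOuterContinuous ν ∧ IsWeaklyInnerContinuous ν →
      IsQSmooth ν ∧ IsWeaklyInnerContinuous ν ∧ IsSaturatedMaxitive ν := fun h =>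
    ⟨(h67 h.1).1, h.2, (h67 h.1).2⟩
  have h59 : IsWeaklyOuterContinuous ν ∧ IsSigmaMaxitive ν →
      IsQSmooth ν ∧ IsSigmaMaxitive ν ∧ IsSaturatedMaxitive ν := fun h =>
    ⟨(h67 h.1).1, h.2, (h67 h.1).2⟩
  have h52 (_ : SecondCountableTopology E) :
      IsWeaklyOuterContinuous ν ∧ IsSigmaMaxitive ν → HasUSCCardinalDensity ν := fun h =>
    h.1.hasUSCCardinalDensity hc hν h.2
  have h84 (_ : LocallyCompactSpace E) :
      IsQSmooth ν ∧ IsWeaklyInnerContinuous ν ∧ IsSaturatedMaxitive ν →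
      IsWeaklyOuterContinuous ν ∧ IsWeaklyInnerContinuous ν := fun h =>
    ⟨h.1.isWeaklyOuterContinuous hν h.2.2, h.2.1⟩
  have h76 (_ : LocallyCompactSpace E) :
      IsWeaklyOuterContinuous ν ↔ IsQSmooth ν ∧ IsSaturatedMaxitive ν :=
    ⟨h67, fun h => h.1.isWeaklyOuterContinuous hν h.2⟩
  have h92 (_ : SigmaCompactSpace E) (_ : TopologicalSpace.MetrizableSpace E) :
      IsQSmooth ν ∧ IsSigmaMaxitive ν ∧ IsSaturatedMaxitive ν → HasUSCCardinalDensity ν := fun h =>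
    h.1.hasUSCCardinalDensity hc hν h.2.1
  refine ⟨hasCardinalDensity_iff_isCompletelyMaxitive, reg, h45, And.left, h67,
    fun h => ⟨h.1, h.2.2⟩, fun h2 => ?_, fun hlc => ⟨?_, h76 hlc⟩, fun hσ hm => ?_,
    fun hlc hp => ⟨?_, h76 hlc⟩⟩
  · specialize h52 h2
    tfae_have 1 ↔ 2 := e12
    tfae_have 1 ↔ 3 := e13
    tfae_have 1 ↔ 4 := e14
    tfae_have 4 → 5 := h45
    tfae_have 5 → 2 := h52
    tfae_finish
  · specialize h84 hlc
    tfae_have 2 ↔ 3 := e12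
    tfae_have 2 ↔ 4 := e13
    tfae_have 2 ↔ 5 := e14
    tfae_have 5 → 1 := h48
    tfae_have 1 → 5 := h84
    tfae_finish
  · specialize h92 hσ hm
    tfae_have 2 ↔ 3 := e12
    tfae_have 2 ↔ 4 := e13
    tfae_have 2 ↔ 5 := e14
    tfae_have 5 → 6 := h45
    tfae_have 6 → 1 := h59
    tfae_have 1 → 3 := h92
    tfae_finish
  · specialize h84 hlc
    -- A locally compact Polish space is metrizable and, being second-countable, σ-compact.
    specialize h92 inferInstance inferInstance
    tfae_have 3 ↔ 4 := e12
    tfae_have 3 ↔ 5 := e13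
    tfae_have 3 ↔ 6 := e14
    tfae_have 6 → 1 := h48
    tfae_have 1 → 6 := h84
    tfae_have 6 → 7 := h45
    tfae_have 7 → 2 := h59
    tfae_have 2 → 4 := h92
    tfae_finish
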